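/- For integers $t_1,\dots,t_n\ge 0$ let $P'(t_1,\dots,t_n)$ be the number of anagrams without fixed letters of the word $\underbrace{1\cdots1}_{t_1}\underbrace{2\cdots2}_{t_2}\cdots\underbrace{n\cdots n}_{t_n}$, that is, the number of distinct rearrangements of its letters such that no position carries the same letter as in the original word. Let $d(n)$ be the number of derangements (permutations without fixed points) of an $n$-element set. Theorem 5.1. For every prime $p$ and every integer $n\ge1$, $$P'(\underbrace{p,\dots,p}_{n})\equiv P'(\underbrace{1,\dots,1}_{n})=d(n)\pmod{p^3},$$ where the equality $P'(1,\dots,1)=d(n)$ is an equality of integers. -/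

import Mathlib

/-- The positions of the word `1…1 2…2 … n…n` whose `i`-th block has length `t i`:
the pair `⟨i, j⟩` is the `j`-th position of the `i`-th block.  The letter of the word at the
position `⟨i, j⟩` is `i`. -/
abbrev BlockPos {n : ℕ} (t : Fin n → ℕ) : Type := (i : Fin n) × Fin (t i)

/-- `w` is an anagram of the word with `t i` letters `i`: every letter `i` occurs exactly
`t i` times in it. -/
def IsAnagram {n : ℕ} (t : Fin n → ℕ) (w : BlockPos t → Fin n) : Prop :=
  ∀ i : Fin n, (Finset.univ.filter fun a : BlockPos t => w a = i).card = t i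

/-- `w` is an anagram without fixed letters: an anagram such that no position carries the letter
which the original word has there. -/
def IsAFL {n : ℕ} (t : Fin n → ℕ) (w : BlockPos t → Fin n) : Prop :=
  IsAnagram t w ∧ ∀ a : BlockPos t, w a ≠ a.1

instance {n : ℕ} (t : Fin n → ℕ) : DecidablePred (IsAnagram t) := fun w =>
  inferInstanceAs (Decidable (∀ i : Fin n,
    (Finset.univ.filter fun a : BlockPos t => w a = i).card = t i))

instance {n : ℕ} (t : Fin n → ℕ) : DecidablePred (IsAFL t) := fun w =>
  inferInstanceAs (Decidable (IsAnagram t w ∧ ∀ a : BlockPos t, w a ≠ a.1))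

/-- `P'(t₁, …, tₙ)`: the number of anagrams without fixed letters of the word with `t i`
letters `i`. -/
def numAFL {n : ℕ} (t : Fin n → ℕ) : ℕ :=
  (Finset.univ.filter fun w : BlockPos t → Fin n => IsAFL t w).card

/-! Sort the words by the set `T` of mixed blocks. For `T = ∅` the words are exactly the
derangements, so the others must number `0` mod `p ^ 3`. Rotating each mixed block independently is
a free action of `(ℤ/p)^T`, because a nonconstant function on `ℤ/p` has no nonzero period; hence `p
^ #T` divides each class, which settles `#T ≥ 3`. The case `#T = 1` is impossible, as there are as
many mixed letters as mixed blocks.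

For `#T = 2` the set `U` of mixed letters is a pair disjoint from `T`. With the other blocks fixed,
there are `∑ C(p,k)²` fillings, `0 < k < p`, a multiple of `p ^ 3` when `p ≥ 5` (Wolstenholme). For
`p = 2, 3` all pairs `(T, U)` have equally many words by symmetry, a multiple of `p ^ 2`, and the
number of pairs is divisible by `6`. -/

open Finset

/-! ### Mixed blocks, mixed letters and relabelling -/

section Words

variable {I J : Type*} [Fintype I] [Fintype J] [DecidableEq I] [DecidableEq J]

/-- Words with blocks indexed by `I`, each with position set `J`, in which every letter occurs
`Fintype.card J` times and no letter `i` occurs in block `i`. -/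
def blockAFL (I J : Type*) [Fintype I] [Fintype J] [DecidableEq I] [DecidableEq J] :
    Finset (I → J → I) :=
  univ.filter fun w => (∀ l, ∑ i, #{j | w i j = l} = Fintype.card J) ∧ ∀ i j, w i j ≠ i

/-- The blocks of a word that contain at least two distinct letters. -/
def mixedBlocks (w : I → J → I) : Finset I := {i | ∃ j j', w i j ≠ w i j'}

/-- The letters occurring in the mixed blocks of a word. -/
def mixedLetters (w : I → J → I) : Finset I := {l | ∃ i ∈ mixedBlocks w, ∃ j, w i j = l}

theorem mem_blockAFL {w : I → J → I} : w ∈ blockAFL I J ↔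
    (∀ l, ∑ i, #{j | w i j = l} = Fintype.card J) ∧ ∀ i j, w i j ≠ i := by
  simp [blockAFL]

omit [DecidableEq J] in
theorem mem_mixedBlocks {w : I → J → I} {i : I} :
    i ∈ mixedBlocks w ↔ ∃ j j', w i j ≠ w i j' := by simp [mixedBlocks]

omit [DecidableEq J] in
theorem notMem_mixedBlocks {w : I → J → I} {i : I} :
    i ∉ mixedBlocks w ↔ ∀ j j', w i j = w i j' := by simp [mixedBlocks]

omit [DecidableEq J] in
theorem mem_mixedLetters {w : I → J → I} {l : I} :
    l ∈ mixedLetters w ↔ ∃ i ∈ mixedBlocks w, ∃ j, w i j = l := by simp [mixedLetters]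

theorem numAFL_const_eq_card {n p : ℕ} (hJ : Fintype.card J = p) :
    numAFL (fun _ : Fin n => p) = #(blockAFL (Fin n) J) := by
  let φ : J ≃ Fin p := Fintype.equivFinOfCardEq hJ
  let e : (BlockPos (fun _ : Fin n => p) → Fin n) ≃ (Fin n → J → Fin n) :=
    { toFun := fun w i j => w ⟨i, φ j⟩
      invFun := fun v a => v a.1 (φ.symm a.2)
      left_inv := fun w => by ext a; simp
      right_inv := fun v => by ext i j; simp }
  refine Finset.card_equiv e fun w => ?_
  rw [mem_blockAFL, hJ, mem_filter, IsAFL, IsAnagram]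
  simp only [mem_univ, true_and]
  refine and_congr (forall_congr' fun l => ?_) ?_
  · rw [Finset.card_filter, Fintype.sum_sigma]
    simp only [Finset.card_filter]
    rw [Finset.sum_congr rfl fun i _ => (Equiv.sum_comp φ fun j => if w ⟨i, j⟩ = l then 1 else 0).symm]
    rfl
  · constructor
    · intro h i j
      exact h ⟨i, φ j⟩
    · rintro h ⟨i, j⟩
      simpa [e] using h i (φ.symm j)

omit [DecidableEq J] in
theorem dvd_card_filter_of_notMem_mixedBlocks {w : I → J → I} {i : I} (hi : i ∉ mixedBlocks w)
    (l : I) : Fintype.card J ∣ #{j | w i j = l} := by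
  rw [notMem_mixedBlocks] at hi
  rcases isEmpty_or_nonempty J with hJ | ⟨⟨j₀⟩⟩
  · simp
  by_cases h : w i j₀ = l
  · rw [filter_true_of_mem fun j _ => (hi j j₀).trans h, card_univ]
  · rw [filter_false_of_mem fun j _ => by rwa [hi j j₀], card_empty]
    exact dvd_zero _

/-- Constant blocks contain `l` either `0` or `#J` times, so the mixed blocks contain it a multiple
of `#J` times: positive, and at most `#J`. -/
theorem sum_mixedBlocks_eq {w : I → J → I} (hw : w ∈ blockAFL I J) {l : I}
    (hl : l ∈ mixedLetters w) : ∑ i ∈ mixedBlocks w, #{j | w i j = l} = Fintype.card J := by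
  have hsum := (mem_blockAFL.1 hw).1 l
  rw [← sum_add_sum_compl (mixedBlocks w)] at hsum
  have h1 : Fintype.card J ∣ ∑ i ∈ (mixedBlocks w)ᶜ, #{j | w i j = l} :=
    dvd_sum fun i hi => dvd_card_filter_of_notMem_mixedBlocks (mem_compl.1 hi) l
  have h2 : Fintype.card J ∣ ∑ i ∈ mixedBlocks w, #{j | w i j = l} :=
    (Nat.dvd_add_left h1).1 (hsum ▸ dvd_rfl)
  obtain ⟨i, hi, j, hj⟩ := mem_mixedLetters.1 hl
  have h3 : 0 < ∑ i ∈ mixedBlocks w, #{j | w i j = l} :=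
    (card_pos.2 ⟨j, by simpa using hj⟩).trans_le
      (single_le_sum (f := fun i => #{j | w i j = l}) (fun _ _ => Nat.zero_le _) hi)
  exact le_antisymm (by omega) (Nat.le_of_dvd h3 h2)

/-- Double count the positions in mixed blocks, by block and by letter. -/
theorem card_mixedLetters [Nonempty J] {w : I → J → I} (hw : w ∈ blockAFL I J) :
    #(mixedLetters w) = #(mixedBlocks w) := by
  have h1 := sum_congr rfl fun l (hl : l ∈ mixedLetters w) => sum_mixedBlocks_eq hw hl
  rw [sum_comm] at h1
  have h2 : ∀ i ∈ mixedBlocks w,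
      ∑ l ∈ mixedLetters w, #{j | w i j = l} = Fintype.card J := fun i hi => by
    rw [← card_univ, card_eq_sum_card_fiberwise (f := w i) (t := mixedLetters w)]
    exact fun j _ => mem_mixedLetters.2 ⟨i, hi, j, rfl⟩
  rw [sum_congr rfl h2] at h1
  simp only [sum_const, smul_eq_mul] at h1
  exact (Nat.eq_of_mul_eq_mul_right Fintype.card_pos h1).symm

omit [DecidableEq J] in
theorem exists_ne_of_mem_mixedBlocks {w : I → J → I} {i : I}
    (hi : i ∈ mixedBlocks w) (a : I) : ∃ j, w i j ≠ a := by
  obtain ⟨j, j', h⟩ := mem_mixedBlocks.1 hi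
  by_contra! h'
  exact h ((h' j).trans (h' j').symm)

theorem card_mixedBlocks_ne_one [Nonempty J] {w : I → J → I} (hw : w ∈ blockAFL I J) :
    #(mixedBlocks w) ≠ 1 := by
  intro h
  have h' := card_mixedLetters hw
  rw [h] at h'
  obtain ⟨i, hi⟩ := card_eq_one.1 h
  obtain ⟨a, ha⟩ := card_eq_one.1 h'
  have hi' : i ∈ mixedBlocks w := by simp [hi]
  obtain ⟨j, hj⟩ := exists_ne_of_mem_mixedBlocks hi' a
  have : w i j ∈ mixedLetters w := mem_mixedLetters.2 ⟨i, hi', j, rfl⟩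
  rw [ha, mem_singleton] at this
  exact hj this

/-- If a mixed block `i` were also a mixed letter, block `i`, which avoids `i`, would have only one
letter left. -/
theorem disjoint_mixedBlocks_mixedLetters [Nonempty J] {w : I → J → I} (hw : w ∈ blockAFL I J)
    (h : #(mixedBlocks w) = 2) : Disjoint (mixedBlocks w) (mixedLetters w) := by
  rw [disjoint_left]
  intro i hi hil
  have h' : #((mixedLetters w).erase i) = 1 := by
    rw [card_erase_of_mem hil, card_mixedLetters hw, h]
  obtain ⟨a, ha⟩ := card_eq_one.1 h'
  obtain ⟨j, hj⟩ := exists_ne_of_mem_mixedBlocks hi a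
  have : w i j ∈ (mixedLetters w).erase i :=
    mem_erase.2 ⟨(mem_blockAFL.1 hw).2 i j, mem_mixedLetters.2 ⟨i, hi, j, rfl⟩⟩
  rw [ha, mem_singleton] at this
  exact hj this

theorem card_mixedBlocks_eq_empty [Nonempty J] :
    #{w ∈ blockAFL I J | mixedBlocks w = ∅} = Fintype.card (derangements I) := by
  rw [← card_univ]
  symm
  refine card_bij (fun σ _ i _ => σ.1 i) ?_ ?_ ?_
  · rintro ⟨σ, hσ⟩ -
    rw [mem_filter, mem_blockAFL]
    refine ⟨⟨fun l => ?_, fun i _ => hσ i⟩, ?_⟩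
    · rw [sum_eq_single (σ.symm l)]
      · simp
      · intro i _ hi
        rw [filter_false_of_mem, card_empty]
        rintro j - rfl
        simp at hi
      · simp
    · ext i
      simp [mem_mixedBlocks]
  · intro σ _ τ _ h
    ext i
    exact congrFun (congrFun h i) (Classical.arbitrary J)
  · intro w hw
    rw [mem_filter, mem_blockAFL] at hw
    obtain ⟨⟨h1, h2⟩, h3⟩ := hw
    have h4 : ∀ i j j', w i j = w i j' := fun i => notMem_mixedBlocks.1 (by simp [h3])
    let j₀ := Classical.arbitrary J
    -- Every letter must occur somewhere, and a surjection of a finite set to itself is a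
    -- permutation.
    have hsurj : Function.Surjective fun i => w i j₀ := by
      intro l
      by_contra! h
      have := h1 l
      rw [sum_eq_zero] at this
      · exact Fintype.card_ne_zero this.symm
      · intro i _
        rw [filter_false_of_mem fun j _ => by rw [h4 i j j₀]; exact h i, card_empty]
    refine ⟨⟨Equiv.ofBijective _ (Finite.injective_iff_bijective.1
      (Finite.injective_iff_surjective.2 hsurj)), fun i => h2 i j₀⟩, mem_univ _, ?_⟩
    ext i j
    exact h4 i j₀ j

theorem numAFL_one_eq_card_derangements (n : ℕ) :
    numAFL (fun _ : Fin n => 1) = Fintype.card (derangements (Fin n)) := by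
  rw [numAFL_const_eq_card (J := Unit) (by simp), ← card_mixedBlocks_eq_empty (J := Unit),
    filter_true_of_mem]
  intro w _
  ext i
  simp [mem_mixedBlocks]

/-- Relabelling the blocks and the letters of a word. -/
def relabel (π : Equiv.Perm I) (w : I → J → I) : I → J → I := fun i j => π (w (π.symm i) j)

theorem relabel_mem_blockAFL (π : Equiv.Perm I) {w : I → J → I} (hw : w ∈ blockAFL I J) :
    relabel π w ∈ blockAFL I J := by
  rw [mem_blockAFL] at hw ⊢
  refine ⟨fun l => ?_, fun i j h => ?_⟩
  · rw [← hw.1 (π.symm l), ← Equiv.sum_comp π]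
    simp [relabel, Equiv.eq_symm_apply]
  · refine hw.2 (π.symm i) j ?_
    rw [Equiv.eq_symm_apply]
    exact h

omit [DecidableEq J] in
theorem mixedBlocks_relabel (π : Equiv.Perm I) (w : I → J → I) :
    mixedBlocks (relabel π w) = (mixedBlocks w).map π.toEmbedding := by
  ext i
  rw [mem_map_equiv]
  simp [mem_mixedBlocks, relabel]

omit [DecidableEq J] in
theorem mixedLetters_relabel (π : Equiv.Perm I) (w : I → J → I) :
    mixedLetters (relabel π w) = (mixedLetters w).map π.toEmbedding := by
  ext l
  rw [mem_map_equiv]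
  simp only [mem_mixedLetters, mixedBlocks_relabel, mem_map_equiv, relabel, Equiv.eq_symm_apply]
  constructor
  · rintro ⟨i, hi, j, hj⟩
    exact ⟨_, hi, j, hj⟩
  · rintro ⟨i, hi, j, hj⟩
    exact ⟨π i, by simpa using hi, j, by simpa using hj⟩

omit [Fintype I] [Fintype J] [DecidableEq I] [DecidableEq J] in
theorem relabel_symm_relabel (π : Equiv.Perm I) (w : I → J → I) :
    relabel π.symm (relabel π w) = w := by
  ext i j
  simp [relabel]

/-- The words with prescribed sets of mixed blocks and of letters in the mixed blocks. -/
def mixedAFL (J : Type*) [Fintype J] [DecidableEq J] (T U : Finset I) : Finset (I → J → I) :=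
  {w ∈ blockAFL I J | mixedBlocks w = T ∧ mixedLetters w = U}

theorem mem_mixedAFL {T U : Finset I} {w : I → J → I} :
    w ∈ mixedAFL J T U ↔ w ∈ blockAFL I J ∧ mixedBlocks w = T ∧ mixedLetters w = U := by
  simp [mixedAFL]

theorem card_mixedAFL_map (π : Equiv.Perm I) (T U : Finset I) :
    #(mixedAFL J (T.map π.toEmbedding) (U.map π.toEmbedding)) = #(mixedAFL J T U) := by
  symm
  refine card_bij' (fun w _ => relabel π w) (fun w _ => relabel π.symm w) ?_ ?_
    (fun w _ => relabel_symm_relabel π w) (fun w _ => relabel_symm_relabel π.symm w)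
  · intro w hw
    obtain ⟨h, rfl, rfl⟩ := mem_mixedAFL.1 hw
    exact mem_mixedAFL.2 ⟨relabel_mem_blockAFL π h, mixedBlocks_relabel π w,
      mixedLetters_relabel π w⟩
  · intro w hw
    obtain ⟨h, h1, h2⟩ := mem_mixedAFL.1 hw
    refine mem_mixedAFL.2 ⟨relabel_mem_blockAFL π.symm h, ?_, ?_⟩
    · rw [mixedBlocks_relabel, h1]
      ext; simp
    · rw [mixedLetters_relabel, h2]
      ext; simp

end Words

/-! ### The action by block rotations -/

section Rotation

variable {I : Type*} [Fintype I] [DecidableEq I] {p : ℕ}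

/-- Cyclic rotation of the blocks of a word, the block `i` being shifted by `g i`. -/
def rotate (g : I → ZMod p) (w : I → ZMod p → I) : I → ZMod p → I := fun i j => w i (j + g i)

variable [NeZero p]

theorem rotate_mem_blockAFL (g : I → ZMod p) {w : I → ZMod p → I}
    (hw : w ∈ blockAFL I (ZMod p)) : rotate g w ∈ blockAFL I (ZMod p) := by
  rw [mem_blockAFL] at hw ⊢
  refine ⟨fun l => ?_, fun i j => hw.2 i _⟩
  rw [← hw.1 l]
  exact sum_congr rfl fun i _ => card_equiv (Equiv.addRight (g i)) fun j => by
    rw [mem_filter, mem_filter]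
    simp [rotate]

theorem mixedBlocks_rotate (g : I → ZMod p) (w : I → ZMod p → I) :
    mixedBlocks (rotate g w) = mixedBlocks w := by
  ext i
  simp only [mem_mixedBlocks, rotate]
  constructor
  · rintro ⟨j, j', h⟩
    exact ⟨_, _, h⟩
  · rintro ⟨j, j', h⟩
    exact ⟨j - g i, j' - g i, by simpa using h⟩

theorem mixedLetters_rotate (g : I → ZMod p) (w : I → ZMod p → I) :
    mixedLetters (rotate g w) = mixedLetters w := by
  ext l
  simp only [mem_mixedLetters, mixedBlocks_rotate, rotate]
  refine exists_congr fun i => and_congr_right fun _ => ?_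
  constructor
  · rintro ⟨j, h⟩
    exact ⟨_, h⟩
  · rintro ⟨j, h⟩
    exact ⟨j - g i, by simpa using h⟩

/-- The block rotations supported on `T` act on the words with set of mixed blocks `T`. -/
instance (T U : Finset I) : AddAction (T → ZMod p) (mixedAFL (ZMod p) T U) where
  vadd g w := ⟨rotate (fun i => if h : i ∈ T then g ⟨i, h⟩ else 0) w.1, by
    obtain ⟨h, h1, h2⟩ := mem_mixedAFL.1 w.2
    exact mem_mixedAFL.2 ⟨rotate_mem_blockAFL _ h, (mixedBlocks_rotate _ _).trans h1,
      (mixedLetters_rotate _ _).trans h2⟩⟩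
  zero_vadd w := Subtype.ext <| by
    change rotate _ w.1 = w.1
    ext i j
    simp [rotate]
  add_vadd g g' w := Subtype.ext <| by
    change rotate _ w.1 = rotate _ (rotate _ w.1)
    ext i j
    by_cases h : i ∈ T <;> simp [rotate, h, add_assoc]

theorem coe_vadd_apply {T U : Finset I} (g : T → ZMod p) (w : mixedAFL (ZMod p) T U) {i : I}
    (hi : i ∈ T) (j : ZMod p) : (g +ᵥ w).1 i j = w.1 i (j + g ⟨i, hi⟩) := by
  change rotate (fun i => if h : i ∈ T then g ⟨i, h⟩ else 0) w.1 i j = _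
  simp [rotate, hi]

end Rotation

/-! ### Freeness of the rotations for prime `p` -/

section Prime

variable {I : Type*} [Fintype I] [DecidableEq I] {p : ℕ} [Fact p.Prime]

theorem apply_eq_apply_zero_of_periodic {X : Type*} {f : ZMod p → X} {c : ZMod p} (hc : c ≠ 0)
    (hf : Function.Periodic f c) (x : ZMod p) : f x = f 0 := by
  -- Every `x` is the multiple `(x / c) * c` of the period.
  have h := hf.nat_mul (x / c).val 0
  rwa [ZMod.natCast_zmod_val, div_mul_cancel₀ x hc, zero_add] at h

theorem pow_card_dvd_card_mixedAFL (T U : Finset I) : p ^ #T ∣ #(mixedAFL (ZMod p) T U) := by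
  have hfree : ∀ w : mixedAFL (ZMod p) T U, AddAction.stabilizer (T → ZMod p) w = ⊥ := by
    intro w
    rw [eq_bot_iff]
    intro g hg
    rw [AddAction.mem_stabilizer_iff] at hg
    rw [AddSubgroup.mem_bot]
    ext ⟨i, hi⟩
    by_contra hne
    have hper : Function.Periodic (w.1 i) (g ⟨i, hi⟩) := fun j => by
      rw [← coe_vadd_apply g w hi, hg]
    have hi' : i ∈ mixedBlocks w.1 := by rwa [(mem_mixedAFL.1 w.2).2.1]
    obtain ⟨j, j', h⟩ := mem_mixedBlocks.1 hi'
    exact h ((apply_eq_apply_zero_of_periodic hne hper j).trans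
      (apply_eq_apply_zero_of_periodic hne hper j').symm)
  have h := Nat.card_congr (AddAction.selfEquivOrbitsQuotientProd hfree)
  rw [Nat.card_prod, Nat.card_eq_fintype_card, Fintype.card_coe,
    Nat.card_eq_fintype_card (α := T → ZMod p), Fintype.card_fun, ZMod.card, Fintype.card_coe] at h
  exact h ▸ dvd_mul_left _ _

end Prime

/-! ### Sums of squared binomial coefficients mod `p ^ 3` -/

section Binomial

variable {p : ℕ}

/-- Consecutive entries of row `p - 1` sum to an entry of row `p` that vanishes mod `p`, so they
only alternate in sign. -/
theorem choose_pred_prime_sq [Fact p.Prime] {k : ℕ} (hk : k < p) :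
    (((p - 1).choose k : ℕ) : ZMod p) ^ 2 = 1 := by
  have hp : p.Prime := Fact.out
  induction k with
  | zero => simp
  | succ k ih =>
    have h : (p - 1).choose k + (p - 1).choose (k + 1) = p.choose (k + 1) := by
      conv_rhs => rw [← Nat.sub_add_cancel hp.one_le]
      exact (Nat.choose_succ_succ _ _).symm
    have h0 : ((p.choose (k + 1) : ℕ) : ZMod p) = 0 :=
      (ZMod.natCast_eq_zero_iff _ _).2 (hp.dvd_choose_self k.succ_ne_zero hk)
    rw [← h, Nat.cast_add] at h0
    rw [← ih (by omega), eq_neg_of_add_eq_zero_right h0, neg_sq]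

theorem cube_dvd_sum_choose_sq (hp : p.Prime) (h5 : 5 ≤ p) :
    p ^ 3 ∣ ∑ k ∈ Ioo 0 p, p.choose k ^ 2 := by
  have := Fact.mk hp
  choose! c hc using fun k (hk : k ∈ Ioo 0 p) =>
    hp.dvd_choose_self (mem_Ioo.1 hk).1.ne' (mem_Ioo.1 hk).2
  have h1 : ∑ k ∈ Ioo 0 p, p.choose k ^ 2 = p ^ 2 * ∑ k ∈ Ioo 0 p, c k ^ 2 := by
    rw [mul_sum]
    exact sum_congr rfl fun k hk => by rw [hc k hk, mul_pow]
  rw [h1, pow_succ p 2]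
  refine mul_dvd_mul_left _ ((ZMod.natCast_eq_zero_iff _ _).1 ?_)
  have h2 : ∀ k ∈ Ioo 0 p, (c k : ZMod p) ^ 2 = ((k : ZMod p)⁻¹) ^ 2 := by
    intro k hk
    obtain ⟨hk0, hkp⟩ := mem_Ioo.1 hk
    have hne : (k : ZMod p) ≠ 0 := by
      rw [Ne, ZMod.natCast_eq_zero_iff]
      exact Nat.not_dvd_of_pos_of_lt hk0 hkp
    -- Cancel `p` in `k * C(p,k) = p * C(p-1,k-1)`; so `c k` is `±1/k` mod `p`.
    have h3 : k * c k = (p - 1).choose (k - 1) := by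
      refine Nat.eq_of_mul_eq_mul_left hp.pos ?_
      have h4 := Nat.add_one_mul_choose_eq (p - 1) (k - 1)
      rw [Nat.sub_add_cancel hp.one_le, Nat.sub_add_cancel hk0, hc k hk] at h4
      rw [h4]
      ring
    have h5 : ((k : ZMod p) * c k) ^ 2 = 1 := by
      rw [← Nat.cast_mul, h3, choose_pred_prime_sq (by omega)]
    rw [inv_pow]
    refine eq_inv_of_mul_eq_one_right ?_
    rw [← mul_pow, h5]
  push_cast
  rw [sum_congr rfl h2]
  -- The exponent must satisfy `2 < p - 1`: this is where `5 ≤ p` enters. Inversion permutes `ZMod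
  -- p`, with `0⁻¹ = 0`, so inverse squares have the same sum.
  have h3 : ∑ x : ZMod p, x ^ 2 = 0 :=
    FiniteField.sum_pow_lt_card_sub_one (ZMod p) 2 (by rw [ZMod.card]; omega)
  rw [← h3, ← Equiv.sum_comp (Equiv.inv (ZMod p))]
  rw [← sum_subset (subset_univ ({0}ᶜ : Finset (ZMod p)))]
  · refine sum_bij' (fun k _ => (k : ZMod p)) (fun x _ => x.val) ?_ ?_ ?_ ?_ ?_
    · intro k hk
      obtain ⟨hk0, hkp⟩ := mem_Ioo.1 hk
      rw [mem_compl, mem_singleton, ZMod.natCast_eq_zero_iff]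
      exact Nat.not_dvd_of_pos_of_lt hk0 hkp
    · intro x hx
      rw [mem_compl, mem_singleton] at hx
      exact mem_Ioo.2 ⟨ZMod.val_pos.2 hx, ZMod.val_lt x⟩
    · intro k hk
      exact ZMod.val_natCast_of_lt (mem_Ioo.1 hk).2
    · intro x _
      exact ZMod.natCast_zmod_val x
    · simp
  · intro x _ hx
    have : x = 0 := by simpa using hx
    simp [this]

end Binomial

/-! ### Words with exactly two mixed blocks -/

section TwoMixedBlocks

variable {I J : Type*} [Fintype I] [Fintype J] [DecidableEq I] [DecidableEq J]

/-- The word which agrees with `w` outside the blocks `r` and `s`, and in these consists of the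
letters `a` and `b`, with `a` at the positions in `X` and `Y` respectively. -/
def twoBlockWord (w : I → J → I) (r s a b : I) (X Y : Finset J) : I → J → I := fun i j =>
  if i = r then (if j ∈ X then a else b) else if i = s then (if j ∈ Y then a else b) else w i j

omit [Fintype I] in
theorem card_filter_ite_mem_eq {X : Finset J} {a b : I} (hab : a ≠ b) (l : I) :
    #{j | (if j ∈ X then a else b) = l} =
      if l = a then #X else if l = b then Fintype.card J - #X else 0 := by
  split_ifs with h1 h2
  · subst h1
    congr 1
    ext j
    by_cases hj : j ∈ X <;> simp [hj, hab.symm]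
  · subst h2
    rw [← card_compl]
    congr 1
    ext j
    by_cases hj : j ∈ X <;> simp [hj, hab]
  · rw [card_eq_zero, filter_eq_empty_iff]
    intro j _
    split_ifs
    · exact Ne.symm h1
    · exact Ne.symm h2

omit [Fintype I] in
theorem ite_mem_filter_eq {w : I → J → I} {a b i : I} (h : ∀ j, w i j = a ∨ w i j = b) (j : J) :
    (if j ∈ ({j | w i j = a} : Finset J) then a else b) = w i j := by
  by_cases hj : w i j = a
  · simp [hj]
  · rw [if_neg (by simpa using hj), (h j).resolve_left hj]

theorem exists_mem_and_notMem_of_card {X : Finset J} (h0 : 0 < #X) (h1 : #X < Fintype.card J) :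
    ∃ j ∈ X, ∃ j', j' ∉ X := by
  obtain ⟨j, hj⟩ := card_pos.1 h0
  obtain ⟨j', hj'⟩ := card_pos.1 (card_compl X ▸ Nat.sub_pos_of_lt h1)
  exact ⟨j, hj, j', mem_compl.1 hj'⟩

theorem apply_eq_or_eq_of_mem_mixedAFL {T : Finset I} {a b i : I} {w : I → J → I}
    (hw : w ∈ mixedAFL J T {a, b}) (hi : i ∈ T) (j : J) : w i j = a ∨ w i j = b := by
  obtain ⟨-, rfl, h⟩ := mem_mixedAFL.1 hw
  have : w i j ∈ mixedLetters w := mem_mixedLetters.2 ⟨i, hi, j, rfl⟩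
  simpa [h] using this

variable {r s a b : I}

theorem sum_eq_card_of_mem_mixedAFL (hrs : r ≠ s) {w : I → J → I}
    (hw : w ∈ mixedAFL J {r, s} {a, b}) {l : I} (hl : l = a ∨ l = b) :
    #{j | w r j = l} + #{j | w s j = l} = Fintype.card J := by
  obtain ⟨h, h1, h2⟩ := mem_mixedAFL.1 hw
  have := sum_mixedBlocks_eq h (l := l) (by simpa [h2] using hl)
  rwa [h1, sum_pair hrs] at this

theorem card_filter_pos_of_mem_mixedAFL {T : Finset I} {i : I} {w : I → J → I}
    (hw : w ∈ mixedAFL J T {a, b}) (hi : i ∈ T) :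
    0 < #{j | w i j = a} ∧ #{j | w i j = a} < Fintype.card J := by
  have hi' : i ∈ mixedBlocks w := by rwa [(mem_mixedAFL.1 hw).2.1]
  constructor
  · obtain ⟨j, hj⟩ := exists_ne_of_mem_mixedBlocks hi' b
    exact card_pos.2
      ⟨j, by simpa using (apply_eq_or_eq_of_mem_mixedAFL hw hi j).resolve_right hj⟩
  · obtain ⟨j, hj⟩ := exists_ne_of_mem_mixedBlocks hi' a
    exact card_lt_univ_of_notMem (x := j) (by simpa using hj)

theorem mixedBlocks_twoBlockWord {w : I → J → I} {X Y : Finset J} (hrs : r ≠ s) (hab : a ≠ b)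
    (hX0 : 0 < #X) (hX1 : #X < Fintype.card J) (hY0 : 0 < #Y) (hY1 : #Y < Fintype.card J)
    (hw : mixedBlocks w = {r, s}) : mixedBlocks (twoBlockWord w r s a b X Y) = {r, s} := by
  ext i
  obtain ⟨x, hx, x', hx'⟩ := exists_mem_and_notMem_of_card hX0 hX1
  obtain ⟨y, hy, y', hy'⟩ := exists_mem_and_notMem_of_card hY0 hY1
  rw [mem_mixedBlocks]
  by_cases hr : i = r
  · subst hr
    simp only [twoBlockWord, if_true, mem_insert, true_or, iff_true]
    exact ⟨x, x', by simpa [hx, hx'] using hab⟩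
  by_cases hs : i = s
  · subst hs
    simp only [twoBlockWord, if_neg hr, if_true, mem_insert, mem_singleton, or_true, iff_true]
    exact ⟨y, y', by simpa [hy, hy'] using hab⟩
  · simp only [twoBlockWord, if_neg hr, if_neg hs]
    rw [← mem_mixedBlocks, hw]

theorem twoBlockWord_mem_mixedAFL {w : I → J → I} {X Y : Finset J} (hrs : r ≠ s) (hab : a ≠ b)
    (hw : w ∈ mixedAFL J {r, s} {a, b})
    (hX0 : 0 < #X) (hX1 : #X < Fintype.card J) (hXY : #X + #Y = Fintype.card J) :
    twoBlockWord w r s a b X Y ∈ mixedAFL J {r, s} {a, b} := by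
  have hT := mixedBlocks_twoBlockWord (w := w) (Y := Y) hrs hab hX0 hX1 (by omega) (by omega)
    (mem_mixedAFL.1 hw).2.1
  -- Both `a` and `b` occur in each of the blocks `r`, `s` of `w`, which has no fixed letters.
  have hne : ∀ i ∈ ({r, s} : Finset I), a ≠ i ∧ b ≠ i := by
    intro i hi
    obtain ⟨j, hj⟩ := card_pos.1 (card_filter_pos_of_mem_mixedAFL hw hi).1
    obtain ⟨j', hj'⟩ := exists_ne_of_mem_mixedBlocks (w := w) (i := i)
      (by rwa [(mem_mixedAFL.1 hw).2.1]) a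
    have h := (mem_blockAFL.1 (mem_mixedAFL.1 hw).1).2 i
    have hj'' := (apply_eq_or_eq_of_mem_mixedAFL hw hi j').resolve_left hj'
    exact ⟨(mem_filter.1 hj).2 ▸ h j, hj'' ▸ h j'⟩
  have hner := hne r (by simp)
  have hnes := hne s (by simp)
  refine mem_mixedAFL.2 ⟨mem_blockAFL.2 ⟨fun l => ?_, fun i j => ?_⟩, hT, ?_⟩
  · rw [← (mem_blockAFL.1 (mem_mixedAFL.1 hw).1).1 l, ← sum_add_sum_compl {r, s},
      ← sum_add_sum_compl {r, s} fun i => #{j | w i j = l}]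
    congr 1
    · rw [sum_pair hrs, sum_pair hrs]
      simp only [twoBlockWord, if_true, if_neg hrs.symm]
      rw [card_filter_ite_mem_eq hab, card_filter_ite_mem_eq hab]
      split_ifs with h1 h2
      · rw [sum_eq_card_of_mem_mixedAFL hrs hw (Or.inl h1), hXY]
      · rw [sum_eq_card_of_mem_mixedAFL hrs hw (Or.inr h2)]
        omega
      · symm
        rw [Nat.add_eq_zero_iff, card_eq_zero, card_eq_zero, filter_eq_empty_iff,
          filter_eq_empty_iff]
        constructor
        · rintro j - rfl
          exact (apply_eq_or_eq_of_mem_mixedAFL hw (by simp) j).elim h1 h2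
        · rintro j - rfl
          exact (apply_eq_or_eq_of_mem_mixedAFL hw (by simp) j).elim h1 h2
    · refine sum_congr rfl fun i hi => ?_
      simp only [mem_compl, mem_insert, mem_singleton, not_or] at hi
      simp only [twoBlockWord, if_neg hi.1, if_neg hi.2]
  · have := (mem_blockAFL.1 (mem_mixedAFL.1 hw).1).2 i j
    unfold twoBlockWord
    split_ifs with h1 h2 h3 h4
    · exact h1 ▸ hner.1
    · exact h1 ▸ hner.2
    · exact h3 ▸ hnes.1
    · exact h3 ▸ hnes.2
    · exact this
  · obtain ⟨x, hx, x', hx'⟩ := exists_mem_and_notMem_of_card hX0 hX1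
    ext l
    rw [mem_mixedLetters, hT]
    constructor
    · rintro ⟨i, hi, j, rfl⟩
      rw [mem_insert, mem_singleton] at hi ⊢
      unfold twoBlockWord
      split_ifs <;> simp_all
    · intro hl
      rw [mem_insert, mem_singleton] at hl
      rcases hl with rfl | rfl
      · exact ⟨r, by simp, x, by simp [twoBlockWord, hx]⟩
      · exact ⟨r, by simp, x', by simp [twoBlockWord, hx']⟩

/-- If block `r` has `k` letters `a`, block `s` has `#J - k`; the two position sets are otherwise
free, giving `C(#J,k)²`. -/
theorem card_filter_agree_outside {w₀ : I → J → I} (hrs : r ≠ s) (hab : a ≠ b)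
    (hw₀ : w₀ ∈ mixedAFL J {r, s} {a, b}) :
    #{w ∈ mixedAFL J {r, s} {a, b} | ∀ i, i ≠ r → i ≠ s → w i = w₀ i} =
      ∑ k ∈ Ioo 0 (Fintype.card J), (Fintype.card J).choose k ^ 2 := by
  have hmaps : ∀ w ∈ ({w ∈ mixedAFL J {r, s} {a, b} | ∀ i, i ≠ r → i ≠ s → w i = w₀ i} :
      Finset (I → J → I)), #{j | w r j = a} ∈ Ioo 0 (Fintype.card J) := fun w hw =>
    mem_Ioo.2 (card_filter_pos_of_mem_mixedAFL (mem_filter.1 hw).1 (by simp))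
  rw [card_eq_sum_card_fiberwise hmaps]
  refine sum_congr rfl fun k hk => ?_
  obtain ⟨hk0, hk1⟩ := mem_Ioo.1 hk
  have hcard : (Fintype.card J).choose k ^ 2 =
      #(powersetCard k (univ : Finset J) ×ˢ
        powersetCard (Fintype.card J - k) (univ : Finset J)) := by
    rw [card_product, card_powersetCard, card_powersetCard, card_univ, Nat.choose_symm hk1.le, sq]
  rw [hcard]
  refine card_bij' (fun w _ => (({j | w r j = a} : Finset J), ({j | w s j = a} : Finset J)))
    (fun XY _ => twoBlockWord w₀ r s a b XY.1 XY.2) ?_ ?_ ?_ ?_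
  · intro w hw
    simp only [mem_filter] at hw
    have := sum_eq_card_of_mem_mixedAFL hrs hw.1.1 (Or.inl rfl)
    simp only [mem_product, mem_powersetCard, subset_univ, true_and]
    omega
  · rintro ⟨X, Y⟩ h
    simp only [mem_product, mem_powersetCard, subset_univ, true_and] at h
    simp only [mem_filter]
    refine ⟨⟨twoBlockWord_mem_mixedAFL hrs hab hw₀ (by omega) (by omega) (by omega),
      fun i hr hs => ?_⟩, ?_⟩
    · ext j
      simp [twoBlockWord, hr, hs]
    · simp only [twoBlockWord, if_true]
      rw [card_filter_ite_mem_eq hab, if_pos rfl, h.1]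
  · intro w hw
    simp only [mem_filter] at hw
    ext i j
    by_cases hr : i = r
    · subst hr
      simp only [twoBlockWord, if_true]
      exact ite_mem_filter_eq (apply_eq_or_eq_of_mem_mixedAFL hw.1.1 (by simp)) j
    by_cases hs : i = s
    · subst hs
      simp only [twoBlockWord, if_neg hr, if_true]
      exact ite_mem_filter_eq (apply_eq_or_eq_of_mem_mixedAFL hw.1.1 (by simp)) j
    · simp only [twoBlockWord, if_neg hr, if_neg hs, hw.1.2 i hr hs]
  · rintro ⟨X, Y⟩ -
    refine Prod.ext ?_ ?_
    · ext j
      by_cases hj : j ∈ X <;> simp [twoBlockWord, hj, hab.symm]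
    · ext j
      by_cases hj : j ∈ Y <;> simp [twoBlockWord, hrs.symm, hj, hab.symm]

/-- Restriction to the other blocks has nonempty fibres all of this size. -/
theorem sum_choose_sq_dvd_card_mixedAFL (hrs : r ≠ s) (hab : a ≠ b) :
    ∑ k ∈ Ioo 0 (Fintype.card J), (Fintype.card J).choose k ^ 2 ∣
      #(mixedAFL J {r, s} {a, b}) := by
  rw [card_eq_sum_card_image fun (w : I → J → I) (i : {i // i ≠ r ∧ i ≠ s}) => w i]
  refine dvd_sum fun g hg => ?_
  obtain ⟨w₀, hw₀, rfl⟩ := mem_image.1 hg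
  rw [← card_filter_agree_outside hrs hab hw₀]
  refine dvd_of_eq (congrArg card (filter_congr fun w _ => ?_))
  rw [funext_iff, Subtype.forall]
  simp only [and_imp]

end TwoMixedBlocks

/-! ### Assembling the divisibility by `p ^ 3` -/

section Main

variable {I : Type*} [Fintype I] [DecidableEq I]

/-- Some permutation of `I` carries one quadruple of distinct elements to the other. -/
theorem card_mixedAFL_pair_eq {J : Type*} [Fintype J] [DecidableEq J] {T U T' U' : Finset I}
    (hT : #T = 2) (hU : #U = 2) (hTU : Disjoint T U) (hT' : #T' = 2) (hU' : #U' = 2)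
    (hTU' : Disjoint T' U') : #(mixedAFL J T U) = #(mixedAFL J T' U') := by
  have key : ∀ T U : Finset I, #T = 2 → #U = 2 → Disjoint T U →
      ∃ f : Fin 4 → I, Function.Injective f ∧ T = {f 0, f 1} ∧ U = {f 2, f 3} := by
    intro T U hT hU hTU
    obtain ⟨r, s, hrs, rfl⟩ := card_eq_two.1 hT
    obtain ⟨a, b, hab, rfl⟩ := card_eq_two.1 hU
    simp only [disjoint_insert_left, mem_insert, mem_singleton, not_or,
      disjoint_singleton_left] at hTU
    refine ⟨![r, s, a, b], ?_, rfl, rfl⟩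
    intro i j h
    fin_cases i <;> fin_cases j <;> simp_all [eq_comm]
  obtain ⟨f, hf, rfl, rfl⟩ := key T U hT hU hTU
  obtain ⟨f', hf', rfl, rfl⟩ := key T' U' hT' hU' hTU'
  obtain ⟨π, hπ⟩ := Equiv.Perm.exists_extending_pair f f' hf hf'
  rw [← card_mixedAFL_map π {f 0, f 1} {f 2, f 3}]
  simp [hπ]

/-- The pairs of disjoint two-element sets. -/
def disjointPairs (I : Type*) [Fintype I] [DecidableEq I] : Finset (Finset I × Finset I) :=
  {TU | #TU.1 = 2 ∧ #TU.2 = 2 ∧ Disjoint TU.1 TU.2}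

theorem six_dvd_card_disjointPairs : 6 ∣ #(disjointPairs I) := by
  have h1 : #(disjointPairs I) =
      #((powersetCard 2 (univ : Finset I)).sigma fun T => powersetCard 2 Tᶜ) := by
    refine card_bij' (fun TU _ => ⟨TU.1, TU.2⟩) (fun TU _ => (TU.1, TU.2)) ?_ ?_
      (fun _ _ => rfl) (fun _ _ => rfl)
    · rintro ⟨T, U⟩ h
      simp only [disjointPairs, mem_filter, mem_univ, true_and] at h
      simp only [mem_sigma, mem_powersetCard, subset_univ, true_and]
      exact ⟨h.1, subset_compl_iff_disjoint_left.2 h.2.2, h.2.1⟩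
    · rintro ⟨T, U⟩ h
      simp only [mem_sigma, mem_powersetCard, subset_univ, true_and] at h
      simp only [disjointPairs, mem_filter, mem_univ, true_and]
      exact ⟨h.1, h.2.2, subset_compl_iff_disjoint_left.1 h.2.1⟩
  -- `C(m,2) * C(m-2,2) = C(m,4) * C(4,2)`, and `C(4,2) = 6`.
  rw [h1, card_sigma, sum_congr rfl fun T hT => by
    rw [card_powersetCard, card_compl, (mem_powersetCard.1 hT).2], sum_const, card_powersetCard,
    card_univ, smul_eq_mul, ← Nat.choose_mul (k := 4) (s := 2) (by norm_num)]
  exact dvd_mul_left _ _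

variable {p : ℕ} [Fact p.Prime]

theorem cube_dvd_sum_card_mixedAFL :
    p ^ 3 ∣ ∑ TU ∈ disjointPairs I, #(mixedAFL (ZMod p) TU.1 TU.2) := by
  have hp : p.Prime := Fact.out
  rcases lt_or_ge p 5 with h5 | h5
  · have hp6 : p ∣ 6 := by
      have := hp.two_le
      interval_cases p
      · norm_num
      · norm_num
      · exact absurd hp (by norm_num)
    rcases (disjointPairs I).eq_empty_or_nonempty with h | ⟨TU, hTU⟩
    · simp [h]
    · have hTU' := (mem_filter.1 hTU).2
      rw [sum_eq_card_nsmul fun TU' h => by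
          have h' := (mem_filter.1 h).2
          exact card_mixedAFL_pair_eq h'.1 h'.2.1 h'.2.2 hTU'.1 hTU'.2.1 hTU'.2.2,
        smul_eq_mul, pow_succ']
      -- One factor `p` comes from the number of pairs, `p ^ 2` from each class.
      refine mul_dvd_mul (hp6.trans six_dvd_card_disjointPairs) ?_
      rw [← hTU'.1]
      exact pow_card_dvd_card_mixedAFL _ _
  · refine dvd_sum fun TU hTU => ?_
    have h := (mem_filter.1 hTU).2
    obtain ⟨r, s, hrs, hT⟩ := card_eq_two.1 h.1
    obtain ⟨a, b, hab, hU⟩ := card_eq_two.1 h.2.1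
    have hdvd := sum_choose_sq_dvd_card_mixedAFL (J := ZMod p) hrs hab
    rw [ZMod.card] at hdvd
    rw [hT, hU]
    exact (cube_dvd_sum_choose_sq hp h5).trans hdvd

theorem cube_dvd_card_mixedBlocks_ne_empty :
    p ^ 3 ∣ #{w ∈ blockAFL I (ZMod p) | ¬ mixedBlocks w = ∅} := by
  rw [← card_filter_add_card_filter_not (s := {w ∈ blockAFL I (ZMod p) | ¬ mixedBlocks w = ∅})
    (fun w => #(mixedBlocks w) = 2)]
  refine dvd_add ?_ ?_
  · rw [card_eq_sum_card_fiberwise (f := fun w => (mixedBlocks w, mixedLetters w))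
      (t := disjointPairs I)]
    · refine cube_dvd_sum_card_mixedAFL.trans
        (dvd_of_eq (sum_congr rfl fun TU hTU => congrArg card (Eq.symm ?_)))
      obtain ⟨T, U⟩ := TU
      have h := (mem_filter.1 hTU).2
      ext w
      simp only [mem_filter, mem_mixedAFL, Prod.mk.injEq]
      constructor
      · rintro ⟨⟨⟨h1, -⟩, -⟩, h2⟩
        exact ⟨h1, h2⟩
      · rintro ⟨h1, rfl, rfl⟩
        refine ⟨⟨⟨h1, fun h0 => ?_⟩, h.1⟩, rfl, rfl⟩
        simp [h0] at h
    · intro w hw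
      obtain ⟨⟨h1, -⟩, h2⟩ : (w ∈ blockAFL I (ZMod p) ∧ ¬ mixedBlocks w = ∅) ∧
        #(mixedBlocks w) = 2 := by simpa using hw
      simpa [disjointPairs] using
        ⟨h2, (card_mixedLetters h1).trans h2, disjoint_mixedBlocks_mixedLetters h1 h2⟩
  · rw [card_eq_sum_card_image fun w => (mixedBlocks w, mixedLetters w)]
    refine dvd_sum fun TU hTU => ?_
    obtain ⟨w, hw, rfl⟩ := mem_image.1 hTU
    simp only [mem_filter] at hw
    have h1 := card_mixedBlocks_ne_one hw.1.1
    have h0 := card_pos.2 (nonempty_iff_ne_empty.2 hw.1.2)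
    -- Neither `0`, `1` nor `2` mixed blocks remain, so there are at least three.
    refine (pow_dvd_pow p (m := 3) (n := #(mixedBlocks w)) (by omega)).trans ?_
    refine (pow_card_dvd_card_mixedAFL (mixedBlocks w) (mixedLetters w)).trans
      (dvd_of_eq (congrArg card (Eq.symm ?_)))
    ext v
    simp only [mem_filter, mem_mixedAFL, Prod.mk.injEq]
    constructor
    · rintro ⟨⟨⟨h1, -⟩, -⟩, h2⟩
      exact ⟨h1, h2⟩
    · rintro ⟨h1, h2, h3⟩
      exact ⟨⟨⟨h1, h2 ▸ hw.1.2⟩, h2 ▸ hw.2⟩, h2, h3⟩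

end Main

theorem theorem5p1 (p : ℕ) (hp : p.Prime) (n : ℕ) (hn : 1 ≤ n) :
    numAFL (fun _ : Fin n => p) ≡ numAFL (fun _ : Fin n => 1) [MOD p ^ 3] ∧
      numAFL (fun _ : Fin n => 1) = Fintype.card (derangements (Fin n)) := by
  have := Fact.mk hp
  refine ⟨?_, numAFL_one_eq_card_derangements n⟩
  rw [numAFL_one_eq_card_derangements, numAFL_const_eq_card (J := ZMod p) (ZMod.card p),
    ← card_filter_add_card_filter_not (s := blockAFL (Fin n) (ZMod p)) (fun w => mixedBlocks w = ∅),
    card_mixedBlocks_eq_empty]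
  exact (Nat.modEq_zero_iff_dvd.2 cube_dvd_card_mixedBlocks_ne_empty).add_left _
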